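/- For $h\ge 1$ let $\mathcal G_h$ be the graph with vertex set $\{0,1,2,\dots\}\times\{0,\dots,h-1\}$ in which two vertices are adjacent if and only if their Euclidean distance is $1$. A growing self-avoiding walk (GSAW) on $\mathcal G_h$ is a finite walk that visits no vertex twice and whose last vertex is trapped, that is, every neighbour in $\mathcal G_h$ of the last vertex lies on the walk. For a GSAW $W$, let $|W|$ be its number of edges and let $\|W\|$ be its displacement, the difference between the largest and the smallest $x$-coordinate of the vertices of $W$. Let $W_{(0,h-1)}(\mathcal G_h)$ be the set of all GSAWs on $\mathcal G_h$ that start at the top-left corner $(0,h-1)$. Theorem. For every $h\ge 1$, the generating function \[ f_h(x,y)=\sum_{W\in W_{(0,h-1)}(\mathcal G_h)} x^{|W|}y^{\|W\|}\in\mathbb Q[[x,y]] \] is rational: there are polynomials $P,Q\in\mathbb Q[x,y]$ with $Q(0,0)\neq 0$ such that $f_h=P/Q$ in $\mathbb Q[[x,y]]$. -/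

import Mathlib

noncomputable section

/-- The grid graph on a set `S` of integer points of the plane: two points of `S` are adjacent
when their Euclidean distance is `1`. -/
def gridGraph (S : Set (ℤ × ℤ)) : SimpleGraph S where
  Adj p q := (p.1.1 - q.1.1) ^ 2 + (p.1.2 - q.1.2) ^ 2 = 1
  symm := ⟨fun p q h => by
    rw [← neg_sub p.1.1, ← neg_sub p.1.2, neg_sq, neg_sq]; exact h⟩
  loopless := ⟨fun p h => by simp at h⟩

/-- The point set `ℕ × {0, …, h - 1}`, where `ℕ` contains `0`. -/
def stripSet (h : ℕ) : Set (ℤ × ℤ) := {p | 0 ≤ p.1 ∧ 0 ≤ p.2 ∧ p.2 < (h : ℤ)}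

/-- The half-infinite grid graph of height `h`. -/
abbrev stripGraph (h : ℕ) : SimpleGraph (stripSet h) := gridGraph (stripSet h)

/-- The top-left corner `(0, h - 1)` of the half-infinite strip of height `h ≥ 1`. -/
def topLeft (h : ℕ) (hh : 1 ≤ h) : stripSet h :=
  ⟨(0, (h : ℤ) - 1), by
    have h1 : (1 : ℤ) ≤ h := by exact_mod_cast hh
    refine ⟨le_refl _, ?_, ?_⟩ <;> dsimp only <;> omega⟩

/-- A growing self-avoiding walk on `G` that starts at `v`: a finite walk that visits no vertex
twice and whose last vertex is trapped, that is, has all its neighbours on the walk. -/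
structure GSAW {V : Type*} (G : SimpleGraph V) (v : V) where
  /-- the last vertex -/
  last : V
  /-- the underlying walk -/
  walk : G.Walk v last
  isPath : walk.IsPath
  trapped : ∀ w : V, G.Adj last w → w ∈ walk.support

namespace GSAW

/-- The length of a growing self-avoiding walk: its number of edges. -/
def length {V : Type*} {G : SimpleGraph V} {v : V} (W : GSAW G v) : ℕ := W.walk.length

/-- The (nonempty) finite set of the first coordinates of the vertices of a walk on a grid graph. -/
def xCoords {S : Set (ℤ × ℤ)} {v : S} (W : GSAW (gridGraph S) v) : Finset ℤ :=
  (W.walk.support.map fun p => p.1.1).toFinset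

theorem xCoords_nonempty {S : Set (ℤ × ℤ)} {v : S} (W : GSAW (gridGraph S) v) :
    W.xCoords.Nonempty :=
  ⟨v.1.1, List.mem_toFinset.2 (List.mem_map.2 ⟨v, W.walk.start_mem_support, rfl⟩)⟩

/-- The displacement: the difference between the largest and the smallest first coordinate of the
vertices of the walk. -/
def displacement {S : Set (ℤ × ℤ)} {v : S} (W : GSAW (gridGraph S) v) : ℤ :=
  W.xCoords.max' W.xCoords_nonempty - W.xCoords.min' W.xCoords_nonempty

end GSAW

/-- The set of growing self-avoiding walks on the grid graph on `S` that start at `v`, have `n`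
edges and displacement `k`. -/
def gsawSet (S : Set (ℤ × ℤ)) (v : S) (n k : ℕ) : Set (GSAW (gridGraph S) v) :=
  {W | W.length = n ∧ W.displacement = (k : ℤ)}

theorem gridGraph_getVert_mem {S : Set (ℤ × ℤ)} {u v : S} (p : (gridGraph S).Walk u v) (i : ℕ) :
    |(p.getVert i).1.1 - u.1.1| ≤ i ∧ |(p.getVert i).1.2 - u.1.2| ≤ i := by
  induction p generalizing i with
  | nil => simp
  | @cons a b c hab q ih =>
    cases i with
    | zero => simp
    | succ i =>
      have h1 := ih i
      have h2 : (a.1.1 - b.1.1) ^ 2 + (a.1.2 - b.1.2) ^ 2 = 1 := hab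
      have h3 : |a.1.1 - b.1.1| ≤ 1 := by
        rw [← sq_le_one_iff_abs_le_one]; nlinarith [sq_nonneg (a.1.2 - b.1.2)]
      have h4 : |a.1.2 - b.1.2| ≤ 1 := by
        rw [← sq_le_one_iff_abs_le_one]; nlinarith [sq_nonneg (a.1.1 - b.1.1)]
      simp only [SimpleGraph.Walk.getVert_cons_succ]
      push_cast
      rw [abs_le] at *
      rw [abs_le] at *
      omega

/-- There are only finitely many walks to count, so the cardinality below is a true count. -/
theorem gsawSet_finite (S : Set (ℤ × ℤ)) (v : S) (n k : ℕ) : (gsawSet S v n k).Finite := by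
  let B : Set (ℤ × ℤ) :=
    Set.Icc (v.1.1 - n) (v.1.1 + n) ×ˢ Set.Icc (v.1.2 - n) (v.1.2 + n)
  have hB : B.Finite := (Set.finite_Icc _ _).prod (Set.finite_Icc _ _)
  have hT : (Set.univ.pi fun _ : Fin (n + 1) => B).Finite := Set.Finite.pi fun _ => hB
  refine Set.Finite.of_finite_image
    (f := fun W (i : Fin (n + 1)) => (W.walk.getVert i).1) (hT.subset ?_) ?_
  · rintro _ ⟨W, -, rfl⟩ i -
    have h := gridGraph_getVert_mem W.walk i
    have hi : ((i : ℕ) : ℤ) ≤ n := by have := i.2; omega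
    simp only [abs_le] at h
    simp only [B, Set.mem_prod, Set.mem_Icc]
    omega
  · rintro ⟨a, p, hp, tp⟩ ⟨hpn, -⟩ ⟨b, q, hq, tq⟩ ⟨hqn, -⟩ hpq
    simp only [GSAW.length] at hpn hqn
    have key : ∀ i, i ≤ n → p.getVert i = q.getVert i := fun i hi =>
      Subtype.ext (congrFun hpq ⟨i, by omega⟩)
    have hab : a = b := by
      have h := key n le_rfl
      rwa [← hpn, p.getVert_length, hpn, ← hqn, q.getVert_length] at h
    subst hab
    have : p = q := SimpleGraph.Walk.ext_getVert_le_length (hpn.trans hqn.symm)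
      fun i hi => key i (hpn ▸ hi)
    subst this
    rfl

/-- The generating function `∑ x^|W| y^‖W‖` over all growing self-avoiding walks `W` on the grid
graph on `S` that start at `v`, as a formal power series in `x` (variable `0`) and `y`
(variable `1`). -/
def gsawSeries (S : Set (ℤ × ℤ)) (v : S) : MvPowerSeries (Fin 2) ℚ :=
  fun m => ((gsawSet S v (m 0) (m 1)).ncard : ℚ)

/-- The generating function `f_h` of the growing self-avoiding walks on the half-infinite strip of
height `h` that start in the top-left corner. -/
def stripSeries (h : ℕ) (hh : 1 ≤ h) : MvPowerSeries (Fin 2) ℚ :=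
  gsawSeries (stripSet h) (topLeft h hh)

/-- A formal power series is rational if it is the quotient `P / Q` of two polynomials, where
`Q` has nonzero constant term and hence is invertible as a power series. -/
def IsRationalSeries (f : MvPowerSeries (Fin 2) ℚ) : Prop :=
  ∃ P Q : MvPolynomial (Fin 2) ℚ, MvPolynomial.constantCoeff Q ≠ 0 ∧
    f = (P : MvPowerSeries (Fin 2) ℚ) * (Q : MvPowerSeries (Fin 2) ℚ)⁻¹

end

/-!
A walk in the strip is cut into columns and becomes a word. The letter at a column consists of the
directed edges that meet this column or the next one, in the order of the walk and up to horizontal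
translation; columns to the left of the start are also labelled with their distance to it. There
are finitely many letters. At a common letter, two walks can be cut and the left part of one glued
to the right part of the other: the strip looks the same from both columns, and whether an edge list
is the edge list of a self-avoiding walk with trapped end is a local condition, apart from the order
of the edges, which the common letter suffices to reconcile. So the left quotient of the language of
these words by a nonempty word is empty or depends only on its last letter, hence there are finitely
many left quotients, and their generating functions solve a linear system with polynomial
coefficients, in which Cramer's rule exhibits a rational solution.
-/

section Languages

variable {α : Type*} {L : Language α}

/-- A language in which two words may be cut at a common letter and glued crosswise. -/
def SwapClosed (L : Language α) : Prop :=
  ∀ ⦃u v u' v' : List α⦄ ⦃a : α⦄, u ++ a :: v ∈ L → u' ++ a :: v' ∈ L → u ++ a :: v' ∈ L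

theorem SwapClosed.leftQuotient_append_singleton (hL : SwapClosed L) {u v : List α} {a : α}
    (h : u ++ a :: v ∈ L) : L.leftQuotient (u ++ [a]) = {v' | ∃ u', u' ++ a :: v' ∈ L} := by
  ext v'
  simp only [Language.mem_leftQuotient, List.append_assoc, List.singleton_append]
  exact ⟨fun h' => ⟨u, h'⟩, fun ⟨_, h'⟩ => hL h h'⟩

theorem SwapClosed.isRegular (hL : SwapClosed L) {T : Finset α} (hT : ∀ l ∈ L, ∀ a ∈ l, a ∈ T) :
    L.IsRegular := by
  refine .of_finite_range_leftQuotient (.subset (((T.finite_toSet.image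
    fun a => ({v' | ∃ u', u' ++ a :: v' ∈ L} : Language α)).insert ∅).insert L) ?_)
  rintro _ ⟨x, rfl⟩
  rcases x.eq_nil_or_concat' with rfl | ⟨u, a, rfl⟩
  · exact .inl (Language.leftQuotient_nil L)
  · rcases (L.leftQuotient (u ++ [a])).eq_empty_or_nonempty with h | ⟨v, hv⟩
    · exact .inr (.inl h)
    · have huav : u ++ a :: v ∈ L := by rw [List.append_cons]; exact hv
      exact .inr (.inr ⟨a, hT _ huav a (by simp), (hL.leftQuotient_append_singleton huav).symm⟩)

end Languages

section LanguageSeries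

variable {α σ : Type*} {L : Language α} {T : Finset α} {w : α → σ →₀ ℕ}

theorem finite_setOf_sum_map_eq (hw : ∀ a, w a ≠ 0) (hT : ∀ l ∈ L, ∀ a ∈ l, a ∈ T) (m : σ →₀ ℕ) :
    {l ∈ L | (l.map w).sum = m}.Finite := by
  have length_le (l : List α) : l.length ≤ (l.map w).sum.degree := by
    induction l with
    | nil => simp
    | cons a l ih =>
      have : (w a).degree ≠ 0 := mt (Finsupp.degree_eq_zero_iff _).1 (hw a)
      simp only [List.length_cons, List.map_cons, List.sum_cons, map_add]
      omega
  refine ((List.finite_length_le T m.degree).image (List.map Subtype.val)).subset ?_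
  rintro l ⟨hl, rfl⟩
  lift l to List T using hT l hl
  exact ⟨l, by simpa using length_le (l.map Subtype.val), rfl⟩

theorem image_cons_setOf_sum_map_eq {a : α} {m : σ →₀ ℕ} (ha : w a ≤ m) :
    List.cons a '' {l ∈ L.leftQuotient [a] | (l.map w).sum = m - w a} =
      {l ∈ L | (l.map w).sum = m ∧ l.head? = some a} := by
  ext l
  simp only [Set.mem_image, Set.mem_ofPred_eq, eq_tsub_iff_add_eq_of_le ha]
  constructor
  · rintro ⟨l, ⟨hl, hm⟩, rfl⟩
    exact ⟨hl, by simpa [add_comm] using hm, rfl⟩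
  · rintro ⟨hl, hm, hhead⟩
    obtain ⟨l, rfl⟩ := List.head?_eq_some_iff.1 hhead
    exact ⟨l, ⟨hl, by simpa [add_comm] using hm⟩, rfl⟩

open Classical in
theorem ncard_setOf_sum_map_eq (hw : ∀ a, w a ≠ 0) (hT : ∀ l ∈ L, ∀ a ∈ l, a ∈ T) (m : σ →₀ ℕ) :
    {l ∈ L | (l.map w).sum = m}.ncard = (if [] ∈ L ∧ m = 0 then 1 else 0) +
      ∑ a ∈ T, if w a ≤ m then
        {l ∈ L.leftQuotient [a] | (l.map w).sum = m - w a}.ncard else 0 := by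
  set S := (finite_setOf_sum_map_eq hw hT m).toFinset
  have mem_S {l : List α} : l ∈ S ↔ l ∈ L ∧ (l.map w).sum = m := by simp [S]
  have head_mem : (S : Set (List α)).MapsTo List.head? T.insertNone := by
    rintro (_ | ⟨a, l⟩) h
    · simp
    · simpa using hT _ (mem_S.1 h).1 a (by simp)
  have card_nil : (S.filter fun l => l.head? = none).card = if [] ∈ L ∧ m = 0 then 1 else 0 := by
    have : (S.filter fun l => l.head? = none) = if [] ∈ L ∧ m = 0 then {[]} else ∅ := by
      ext l
      split_ifs with h <;> cases l <;> simp_all [eq_comm]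
    rw [this]
    split_ifs <;> rfl
  have card_cons (a : α) : (S.filter fun l => l.head? = some a).card =
      if w a ≤ m then {l ∈ L.leftQuotient [a] | (l.map w).sum = m - w a}.ncard else 0 := by
    split_ifs with ha
    · rw [← Set.ncard_image_of_injective _ List.cons_injective, image_cons_setOf_sum_map_eq ha,
        ← Set.ncard_coe_finset]
      congr 1
      ext l
      simp [mem_S, and_assoc]
    · rw [Finset.card_eq_zero, Finset.filter_eq_empty_iff]
      rintro (_ | ⟨b, l⟩) h hb
      · simp at hb
      · obtain rfl : b = a := by simpa using hb
        exact ha ((mem_S.1 h).2 ▸ by simp)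
  rw [Set.ncard_eq_toFinset_card _ (finite_setOf_sum_map_eq hw hT m),
    Finset.card_eq_sum_card_fiberwise head_mem, Finset.sum_insertNone, card_nil]
  simp only [card_cons]

/-- The generating function of a language, in which a word counts as the monomial whose exponent
is the total weight of its letters. A monomial that belongs to infinitely many words is counted with
coefficient `0`. -/
noncomputable def languageSeries (R : Type*) [NatCast R] (w : α → σ →₀ ℕ) (L : Language α) :
    MvPowerSeries σ R :=
  fun m => ({l ∈ L | (l.map w).sum = m}.ncard : R)

theorem coeff_languageSeries (R : Type*) [Semiring R] (w : α → σ →₀ ℕ) (L : Language α)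
    (m : σ →₀ ℕ) :
    MvPowerSeries.coeff m (languageSeries R w L) = ({l ∈ L | (l.map w).sum = m}.ncard : R) :=
  rfl

open Classical in
theorem languageSeries_eq_add_sum_leftQuotient (R : Type*) [CommSemiring R] (hw : ∀ a, w a ≠ 0)
    (hT : ∀ l ∈ L, ∀ a ∈ l, a ∈ T) :
    languageSeries R w L = (if [] ∈ L then 1 else 0) +
      ∑ a ∈ T, MvPowerSeries.monomial (w a) 1 * languageSeries R w (L.leftQuotient [a]) := by
  ext m
  rw [coeff_languageSeries, ncard_setOf_sum_map_eq hw hT, map_add, map_sum]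
  push_cast
  congr 1
  · split_ifs <;> simp_all [MvPowerSeries.coeff_one]
  · exact Finset.sum_congr rfl fun a _ => by
      simp only [MvPowerSeries.coeff_monomial_mul, one_mul, coeff_languageSeries]

end LanguageSeries

section RationalSeries

open MvPolynomial (coeToMvPowerSeries constantCoeff)

theorem IsRationalSeries.of_mul_eq {f : MvPowerSeries (Fin 2) ℚ} {P Q : MvPolynomial (Fin 2) ℚ}
    (hQ : constantCoeff Q ≠ 0) (h : (Q : MvPowerSeries (Fin 2) ℚ) * f = P) :
    IsRationalSeries f := by
  refine ⟨P, Q, hQ, ?_⟩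
  rw [MvPowerSeries.eq_mul_inv_iff_mul_eq, mul_comm, h]
  rwa [← MvPowerSeries.coeff_zero_eq_constantCoeff_apply, MvPolynomial.coeff_coe]

/-- Cramer's rule for `(1 - M) g = v`: the common denominator is `det (1 - M)`, with constant
term `1`. -/
theorem exists_common_denominator {R σ ι : Type*} [CommRing R] [Fintype ι]
    {g : ι → MvPowerSeries σ R} {v : ι → MvPolynomial σ R} {M : Matrix ι ι (MvPolynomial σ R)}
    (hM : ∀ i j, constantCoeff (M i j) = 0)
    (hg : ∀ i, g i = (v i : MvPowerSeries σ R) + ∑ j, (M i j : MvPowerSeries σ R) * g j) :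
    ∃ Q : MvPolynomial σ R, constantCoeff Q = 1 ∧
      ∀ i, ∃ P : MvPolynomial σ R, (Q : MvPowerSeries σ R) * g i = P := by
  classical
  let φ : MvPolynomial σ R →+* MvPowerSeries σ R := coeToMvPowerSeries.ringHom
  have system : (φ.mapMatrix (1 - M)).mulVec g = φ ∘ v := by
    ext1 i
    rw [map_sub, map_one, Matrix.sub_mulVec, Matrix.one_mulVec, Pi.sub_apply, sub_eq_iff_eq_add]
    exact hg i
  have cramer : φ (1 - M).det • g = φ ∘ (1 - M).adjugate.mulVec v := by
    have := congrArg (φ.mapMatrix (1 - M)).adjugate.mulVec system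
    rw [Matrix.mulVec_mulVec, Matrix.adjugate_mul, Matrix.smul_mulVec, Matrix.one_mulVec] at this
    rw [RingHom.map_det, this, ← RingHom.map_adjugate]
    ext1 i
    exact (RingHom.map_mulVec φ _ v i).symm
  refine ⟨(1 - M).det, ?_, fun i => ⟨_, congrFun cramer i⟩⟩
  have : constantCoeff.mapMatrix (1 - M) = 1 := by
    rw [map_sub, map_one, sub_eq_self]
    ext i j
    exact hM i j
  rw [RingHom.map_det, this, Matrix.det_one]

theorem isRationalSeries_languageSeries {α : Type*} {L : Language α} (hL : L.IsRegular)
    {T : Finset α} (hT : ∀ l ∈ L, ∀ a ∈ l, a ∈ T) {w : α → Fin 2 →₀ ℕ} (hw : ∀ a, w a ≠ 0) :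
    IsRationalSeries (languageSeries ℚ w L) := by
  classical
  have := hL.finite_range_leftQuotient.fintype
  let next (K : Set.range L.leftQuotient) (a : α) : Set.range L.leftQuotient :=
    ⟨K.1.leftQuotient [a], by
      obtain ⟨_, u, rfl⟩ := K
      exact ⟨u ++ [a], Language.leftQuotient_append L u [a]⟩⟩
  have mem_T (K : Set.range L.leftQuotient) : ∀ l ∈ K.1, ∀ a ∈ l, a ∈ T := by
    obtain ⟨_, u, rfl⟩ := K
    exact fun l hl a ha => hT _ hl a (List.mem_append_right u ha)
  obtain ⟨Q, hQ, hP⟩ := exists_common_denominator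
    (g := fun K : Set.range L.leftQuotient => languageSeries ℚ w K.1)
    (v := fun K => if [] ∈ K.1 then 1 else 0)
    (M := fun K K' => ∑ a ∈ T with next K a = K', MvPolynomial.monomial (w a) 1)
    (fun K K' => by simp [MvPolynomial.constantCoeff_monomial, hw])
    (fun K => by
      rw [languageSeries_eq_add_sum_leftQuotient ℚ hw (mem_T K)]
      congr 1
      · split_ifs <;> simp
      · calc
          ∑ a ∈ T, MvPowerSeries.monomial (w a) 1 * languageSeries ℚ w (next K a).1
            = ∑ a ∈ T, ∑ K', if next K a = K' then
                MvPowerSeries.monomial (w a) 1 * languageSeries ℚ w K'.1 else 0 := by simp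
          _ = _ := by
            rw [Finset.sum_comm]
            refine Finset.sum_congr rfl fun K' _ => ?_
            rw [← Finset.sum_filter, ← Finset.sum_mul]
            congr 1
            rw [← coeToMvPowerSeries.ringHom_apply, map_sum]
            simp)
  obtain ⟨P, hP⟩ := hP ⟨L, [], L.leftQuotient_nil⟩
  exact .of_mul_eq (hQ ▸ one_ne_zero) hP

theorem X_dvd_of_X_dvd_coe {σ R : Type*} [CommRing R] {s : σ} {P : MvPolynomial σ R}
    (h : MvPowerSeries.X s ∣ (P : MvPowerSeries σ R)) : MvPolynomial.X s ∣ P := by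
  rw [MvPolynomial.X_dvd_iff_modMonomial_eq_zero]
  ext m
  by_cases hm : Finsupp.single s 1 ≤ m
  · rw [MvPolynomial.coeff_modMonomial_of_le _ hm, MvPolynomial.coeff_zero]
  · rw [MvPolynomial.coeff_modMonomial_of_not_le _ hm, ← MvPolynomial.coeff_coe,
      MvPowerSeries.X_dvd_iff.1 h m (by simpa using hm), MvPolynomial.coeff_zero]

theorem IsRationalSeries.of_X_mul {s : Fin 2} {f : MvPowerSeries (Fin 2) ℚ}
    (h : IsRationalSeries (MvPowerSeries.X s * f)) : IsRationalSeries f := by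
  obtain ⟨P, Q, hQ, h⟩ := h
  have hQ' : MvPowerSeries.constantCoeff (Q : MvPowerSeries (Fin 2) ℚ) ≠ 0 := by
    rwa [← MvPowerSeries.coeff_zero_eq_constantCoeff_apply, MvPolynomial.coeff_coe]
  rw [MvPowerSeries.eq_mul_inv_iff_mul_eq hQ', mul_assoc] at h
  obtain ⟨P', rfl⟩ := X_dvd_of_X_dvd_coe (Dvd.intro _ h)
  rw [MvPolynomial.coe_mul, MvPolynomial.coe_X] at h
  refine .of_mul_eq (P := P') hQ ((mul_comm _ _).trans ?_)
  exact mul_left_cancel₀ (nonZeroDivisors.ne_zero MvPowerSeries.X_mem_nonzeroDivisors) h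

end RationalSeries

section EdgeLists

variable {V : Type*} {X Y : Set V} {v v' : V} {d : V × V} {l l' A B : List (V × V)}

/-- A list of directed edges that chains up from the vertex `v`, except that it may jump freely
between vertices outside `X`. -/
def ChainOn (X : Set V) : V → List (V × V) → Prop
  | _, [] => True
  | v, d :: l => (v = d.1 ∨ v ∉ X ∧ d.1 ∉ X) ∧ ChainOn X d.2 l

open Classical in
/-- The sublist of the edges that have an endpoint in `X`. -/
noncomputable def touching (X : Set V) (l : List (V × V)) : List (V × V) :=
  l.filter fun d => d.1 ∈ X ∨ d.2 ∈ X

theorem mem_touching : d ∈ touching X l ↔ d ∈ l ∧ (d.1 ∈ X ∨ d.2 ∈ X) := by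
  simp [touching]

@[simp] theorem touching_nil : touching X ([] : List (V × V)) = [] := rfl

theorem touching_cons_of_fst_mem (h : d.1 ∈ X) : touching X (d :: l) = d :: touching X l := by
  simp [touching, h]

theorem touching_cons_of_snd_mem (h : d.2 ∈ X) : touching X (d :: l) = d :: touching X l := by
  simp [touching, h]

theorem touching_cons_of_notMem (h : d.1 ∉ X) (h' : d.2 ∉ X) :
    touching X (d :: l) = touching X l := by
  simp [touching, h, h']

theorem touching_touching_of_subset (hXY : X ⊆ Y) (l : List (V × V)) :
    touching X (touching Y l) = touching X l := by
  simp only [touching, List.filter_filter]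
  refine List.filter_congr fun d _ => ?_
  have h1 := @hXY d.1
  have h2 := @hXY d.2
  grind

theorem touching_comm (X Y : Set V) (l : List (V × V)) :
    touching X (touching Y l) = touching Y (touching X l) :=
  List.filter_comm ..

theorem ChainOn.eq_fst (h : ChainOn Set.univ v (d :: l)) : v = d.1 := by
  simpa using h.1

theorem ChainOn.mem_map_fst (h : ChainOn Set.univ v l) (hl : l ≠ []) : v ∈ l.map Prod.fst := by
  obtain ⟨d, l, rfl⟩ := List.exists_cons_of_ne_nil hl
  simp [h.eq_fst]

theorem ChainOn.of_notMem (h : ChainOn X v l) (hv : v ∉ X) (hv' : v' ∉ X) : ChainOn X v' l := by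
  cases l with
  | nil => trivial
  | cons d l => exact ⟨.inr ⟨hv', h.1.elim (fun hd => hd ▸ hv) And.right⟩, h.2⟩

theorem ChainOn.touching (h : ChainOn Set.univ v l) : ChainOn X v (touching X l) := by
  induction l generalizing v with
  | nil => trivial
  | cons d l ih =>
    by_cases hd : d.1 ∈ X ∨ d.2 ∈ X
    · rw [touching, List.filter_cons_of_pos (by simpa using hd)]
      exact ⟨.inl h.eq_fst, ih h.2⟩
    · push Not at hd
      rw [touching_cons_of_notMem hd.1 hd.2]
      exact (ih h.2).of_notMem hd.2 (h.eq_fst ▸ hd.1)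

theorem ChainOn.map_fst_sublist (h : ChainOn Set.univ v l) :
    (l.map Prod.fst).Sublist (v :: l.map Prod.snd) := by
  induction l generalizing v with
  | nil => exact List.nil_sublist _
  | cons d l ih => exact h.eq_fst ▸ (ih h.2).cons_cons _

theorem ChainOn.eq_of_perm (h : ChainOn Set.univ v l) (h' : ChainOn Set.univ v l')
    (hl : (l.map Prod.fst).Nodup) (hp : l.Perm l') : l = l' := by
  induction l generalizing v l' with
  | nil => exact hp.nil_eq
  | cons d l ih =>
    obtain ⟨d', l', rfl⟩ := List.exists_cons_of_length_eq_add_one hp.length_eq.symm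
    obtain rfl : d = d' := List.inj_on_of_nodup_map hl (by simp) (hp.mem_iff.2 (by simp))
      (h.eq_fst.symm.trans h'.eq_fst)
    rw [ih h.2 h'.2 (List.nodup_cons.1 hl).2 ((List.perm_cons d).1 hp)]

/-- The lists `A` and `B` look like the edges of one chain from `v` that touch `X` and its
complement, respectively. -/
structure Compatible (X : Set V) (v : V) (A B : List (V × V)) : Prop where
  left_touches : ∀ a ∈ A, a.1 ∈ X ∨ a.2 ∈ X
  right_touches : ∀ b ∈ B, b.1 ∈ Xᶜ ∨ b.2 ∈ Xᶜ
  left_chain : ChainOn X v A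
  right_chain : ChainOn Xᶜ v B
  crossing_eq : touching Xᶜ A = touching X B

namespace Compatible

theorem symm (h : Compatible X v A B) : Compatible Xᶜ v B A where
  left_touches := h.right_touches
  right_touches := by simpa using h.left_touches
  left_chain := h.right_chain
  right_chain := by simpa using h.left_chain
  crossing_eq := by simpa using h.crossing_eq.symm

theorem fst_mem_of_cons_right {b : V × V} (h : Compatible X v A (b :: B)) (hv : v ∈ X) :
    b.1 ∈ X :=
  h.right_chain.1.elim (fun hb => hb ▸ hv) fun hb => not_not.1 hb.2

theorem eq_fst_of_cons_left {a : V × V} (h : Compatible X v (a :: A) B) (hv : v ∈ X) : v = a.1 :=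
  h.left_chain.1.resolve_right fun ha => ha.1 hv

theorem eq_nil_of_nil_left (h : Compatible X v [] B) (hv : v ∈ X) : B = [] := by
  cases B with
  | nil => rfl
  | cons b B =>
    have := h.crossing_eq
    simp [touching_cons_of_fst_mem (h.fst_mem_of_cons_right hv)] at this

theorem tail_of_snd_mem {a : V × V} (h : Compatible X v (a :: A) B) (hv : v ∈ X) (ha : a.2 ∈ X) :
    Compatible X a.2 A B where
  left_touches a' ha' := h.left_touches a' (by simp [ha'])
  right_touches := h.right_touches
  left_chain := h.left_chain.2
  right_chain := h.right_chain.of_notMem (by simpa) (by simpa)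
  crossing_eq := by
    have hav : a.1 ∈ X := h.eq_fst_of_cons_left hv ▸ hv
    rw [← h.crossing_eq, touching_cons_of_notMem (by simpa) (by simpa)]

theorem exists_cons_of_snd_notMem {a : V × V} (h : Compatible X v (a :: A) B) (hv : v ∈ X)
    (ha : a.2 ∉ X) : ∃ B', B = a :: B' ∧ Compatible X a.2 A B' := by
  have hcross := h.crossing_eq
  rw [touching_cons_of_snd_mem ha] at hcross
  cases B with
  | nil => simp at hcross
  | cons b B =>
    rw [touching_cons_of_fst_mem (h.fst_mem_of_cons_right hv)] at hcross
    obtain ⟨rfl, hcross'⟩ := List.cons.inj hcross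
    exact ⟨B, rfl, fun a' ha' => h.left_touches a' (by simp [ha']),
      fun b hb => h.right_touches b (by simp [hb]), h.left_chain.2, h.right_chain.2, hcross'⟩

theorem exists_amalgam (h : Compatible X v A B) :
    ∃ l, ChainOn Set.univ v l ∧ touching X l = A ∧ touching Xᶜ l = B := by
  induction hn : A.length + B.length using Nat.strong_induction_on generalizing X v A B with
  | _ n ih =>
  wlog hv : v ∈ X generalizing X A B
  · obtain ⟨l, hl, hB, hA⟩ := this h.symm ((add_comm _ _).trans hn) hv
    exact ⟨l, hl, by simpa using hA, hB⟩
  cases A with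
  | nil => exact ⟨[], trivial, rfl, (h.eq_nil_of_nil_left hv).symm⟩
  | cons a A =>
    have hva := h.eq_fst_of_cons_left hv
    have haX : a.1 ∈ X := hva ▸ hv
    rw [List.length_cons] at hn
    by_cases ha : a.2 ∈ X
    · obtain ⟨l, hl, rfl, rfl⟩ := ih _ (by omega) (h.tail_of_snd_mem hv ha) rfl
      exact ⟨a :: l, ⟨.inl hva, hl⟩, touching_cons_of_fst_mem haX,
        touching_cons_of_notMem (by simpa) (by simpa)⟩
    · obtain ⟨B, rfl, h'⟩ := h.exists_cons_of_snd_notMem hv ha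
      obtain ⟨l, hl, rfl, rfl⟩ := ih _ (by rw [List.length_cons] at hn; omega) h' rfl
      exact ⟨a :: l, ⟨.inl hva, hl⟩, touching_cons_of_fst_mem haX, touching_cons_of_snd_mem ha⟩

end Compatible

end EdgeLists

section Columns

/-- A directed edge between two points of the plane. -/
abbrev PlaneEdge : Type := (ℤ × ℤ) × (ℤ × ℤ)

/-- The sublist of the edges with an endpoint on the vertical line at `t`. -/
noncomputable def column (t : ℤ) (D : List PlaneEdge) : List PlaneEdge :=
  touching {p | p.1 = t} D

/-- Horizontal translation of a list of edges. -/
def shiftEdges (s : ℤ) (D : List PlaneEdge) : List PlaneEdge :=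
  D.map (· + ((s, 0), (s, 0)))

variable {v w : ℤ × ℤ} {i s t : ℤ} {d : PlaneEdge} {D D' : List PlaneEdge}

theorem mem_column : d ∈ column t D ↔ d ∈ D ∧ (d.1.1 = t ∨ d.2.1 = t) :=
  mem_touching

theorem mem_map_fst_column : v ∈ (column v.1 D).map Prod.fst ↔ v ∈ D.map Prod.fst := by
  simp only [List.mem_map, mem_column]
  exact ⟨fun ⟨d, hd, hv⟩ => ⟨d, hd.1, hv⟩, fun ⟨d, hd, hv⟩ => ⟨d, ⟨hd, .inl (hv ▸ rfl)⟩, hv⟩⟩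

theorem mem_map_snd_column : v ∈ (column v.1 D).map Prod.snd ↔ v ∈ D.map Prod.snd := by
  simp only [List.mem_map, mem_column]
  exact ⟨fun ⟨d, hd, hv⟩ => ⟨d, hd.1, hv⟩, fun ⟨d, hd, hv⟩ => ⟨d, ⟨hd, .inr (hv ▸ rfl)⟩, hv⟩⟩

theorem count_column_fst (d : PlaneEdge) (D : List PlaneEdge) :
    (column d.1.1 D).count d = D.count d :=
  List.count_filter (by simp)

theorem perm_of_forall_column_eq (h : ∀ t, column t D = column t D') : D.Perm D' :=
  List.perm_iff_count.2 fun d => by rw [← count_column_fst, h, count_column_fst]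

theorem nodup_map_snd_of_forall_column (h : ∀ t, ((column t D).map Prod.snd).Nodup) :
    (D.map Prod.snd).Nodup := by
  refine List.nodup_iff_count_le_one.2 fun p => ?_
  convert List.nodup_iff_count_le_one.1 (h p.1) p using 1
  simp only [List.count, List.countP_map, column, touching, List.countP_filter]
  refine List.countP_congr fun d _ => ?_
  have : d.2 = p → d.2.1 = p.1 := congrArg Prod.fst
  simpa using fun hd => .inr (this hd)

theorem column_shiftEdges (s t : ℤ) (D : List PlaneEdge) :
    column t (shiftEdges s D) = shiftEdges s (column (t - s) D) := by
  simp only [column, touching, shiftEdges, List.filter_map]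
  congr 1
  refine List.filter_congr fun d _ => ?_
  simp [eq_sub_iff_add_eq]

theorem shiftEdges_injective (s : ℤ) : Function.Injective (shiftEdges s) :=
  List.map_injective_iff.2 (add_left_injective _)

theorem shiftEdges_zero (D : List PlaneEdge) : shiftEdges 0 D = D :=
  List.map_id'' add_zero D

theorem shiftEdges_shiftEdges (s t : ℤ) (D : List PlaneEdge) :
    shiftEdges s (shiftEdges t D) = shiftEdges (t + s) D := by
  simp [shiftEdges, Function.comp_def, add_assoc]

theorem ChainOn.shiftEdges (h : ChainOn Set.univ v D) (s : ℤ) :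
    ChainOn Set.univ (v + (s, 0)) (shiftEdges s D) := by
  induction D generalizing v with
  | nil => trivial
  | cons d D ih => exact ⟨.inl (h.eq_fst ▸ rfl), ih h.2⟩

theorem touching_compl_touching_eq_column (hD : ∀ d ∈ D, |d.1.1 - d.2.1| ≤ 1) :
    touching {p : ℤ × ℤ | p.1 ≤ i}ᶜ (touching {p | p.1 ≤ i} D) =
      touching {p | p.1 ≤ i}ᶜ (touching {p | p.1 ≤ i} (column i D)) := by
  simp only [touching, column, List.filter_filter]
  refine List.filter_congr fun d hd => ?_
  have := abs_le.1 (hD d hd)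
  rw [Bool.eq_iff_iff]
  simp only [Set.mem_compl_iff, Set.mem_ofPred_eq, Bool.and_eq_true, decide_eq_true_eq]
  omega

theorem exists_chain_glue (hD : ChainOn Set.univ v D) (hD' : ChainOn Set.univ w D')
    (hvw : v = w ∨ v.1 ≤ i ∧ w.1 ≤ i) (sD : ∀ d ∈ D, |d.1.1 - d.2.1| ≤ 1)
    (sD' : ∀ d ∈ D', |d.1.1 - d.2.1| ≤ 1) (h0 : column i D = column i D')
    (h1 : column (i + 1) D = column (i + 1) D') :
    ∃ E, ChainOn Set.univ v E ∧ (∀ t ≤ i + 1, column t E = column t D) ∧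
      ∀ t ≥ i, column t E = column t D' := by
  set X : Set (ℤ × ℤ) := {p | p.1 ≤ i} with hX
  have right_chain : ChainOn Xᶜ v (touching Xᶜ D') := by
    rcases hvw with rfl | hvw
    · exact hD'.touching
    · exact hD'.touching.of_notMem (by simpa [hX] using hvw.2) (by simpa [hX] using hvw.1)
  have compatible : Compatible X v (touching X D) (touching Xᶜ D') :=
    ⟨fun a ha => (mem_touching.1 ha).2, fun a ha => (mem_touching.1 ha).2, hD.touching,
      right_chain, by rw [touching_comm X, touching_compl_touching_eq_column sD,
        touching_compl_touching_eq_column sD', h0]⟩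
  obtain ⟨E, hE, left_eq, right_eq⟩ := compatible.exists_amalgam
  have column_left : ∀ t ≤ i, column t E = column t D := fun t ht => by
    have hsub : {p : ℤ × ℤ | p.1 = t} ⊆ X := fun p hp => hp.trans_le ht
    rw [column, ← touching_touching_of_subset hsub, left_eq, touching_touching_of_subset hsub,
      column]
  have column_right : ∀ t > i, column t E = column t D' := fun t ht => by
    have hsub : {p : ℤ × ℤ | p.1 = t} ⊆ Xᶜ := fun p hp => not_le.2 (ht.trans_eq hp.symm)
    rw [column, ← touching_touching_of_subset hsub, right_eq, touching_touching_of_subset hsub,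
      column]
  refine ⟨E, hE, fun t ht => ?_, fun t ht => ?_⟩
  · rcases (show t ≤ i ∨ t = i + 1 by omega) with ht | rfl
    · exact column_left t ht
    · rw [column_right _ (by omega), h1]
  · rcases ht.lt_or_eq with ht | rfl
    · exact column_right t ht
    · rw [column_left _ le_rfl, h0]

end Columns

section TrappedPaths

/-- Adjacency of the integer lattice points of the plane. -/
def UnitDist (p q : ℤ × ℤ) : Prop := (p.1 - q.1) ^ 2 + (p.2 - q.2) ^ 2 = 1

/-- At the column `t`, the edge list `D` looks like the edges of a self-avoiding walk on the grid
graph on `S` whose last vertex is trapped. -/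
structure LocallyTrapped (S : Set (ℤ × ℤ)) (D : List PlaneEdge) (t : ℤ) : Prop where
  mem : ∀ d ∈ D, d.1.1 = t → d.1 ∈ S ∧ d.2 ∈ S
  unitDist : ∀ d ∈ D, d.1.1 = t → UnitDist d.1 d.2
  nodup : ((column t D).map Prod.snd).Nodup
  trapped : ∀ p ∈ D.map Prod.snd, p.1 = t → p ∉ D.map Prod.fst → ∀ q ∈ S, UnitDist p q →
    q ∈ D.map Prod.fst ∨ q ∈ D.map Prod.snd

/-- The edge list of a self-avoiding walk on the grid graph on `S` from `v` to a trapped vertex. -/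
structure IsTrappedPath (S : Set (ℤ × ℤ)) (v : ℤ × ℤ) (D : List PlaneEdge) : Prop where
  chain : ChainOn Set.univ v D
  start_notMem : v ∉ D.map Prod.snd
  locallyTrapped : ∀ t, LocallyTrapped S D t

variable {S : Set (ℤ × ℤ)} {v p q : ℤ × ℤ} {i s t : ℤ} {d : PlaneEdge} {D D' : List PlaneEdge}

theorem UnitDist.abs_fst_sub_le (h : UnitDist p q) : |p.1 - q.1| ≤ 1 := by
  have : (p.1 - q.1) ^ 2 + (p.2 - q.2) ^ 2 = 1 := h
  rw [← sq_le_one_iff_abs_le_one]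
  nlinarith [sq_nonneg (p.2 - q.2)]

theorem LocallyTrapped.congr (h : LocallyTrapped S D t)
    (hD : ∀ u, |t - u| ≤ 1 → column u D' = column u D) : LocallyTrapped S D' t := by
  have hfst : ∀ p : ℤ × ℤ, |t - p.1| ≤ 1 → (p ∈ D'.map Prod.fst ↔ p ∈ D.map Prod.fst) :=
    fun p hp => by rw [← mem_map_fst_column, hD _ hp, mem_map_fst_column]
  have hsnd : ∀ p : ℤ × ℤ, |t - p.1| ≤ 1 → (p ∈ D'.map Prod.snd ↔ p ∈ D.map Prod.snd) :=
    fun p hp => by rw [← mem_map_snd_column, hD _ hp, mem_map_snd_column]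
  have hmem : ∀ d ∈ D', d.1.1 = t → d ∈ D := fun d hd hdt =>
    (mem_column.1 (hD t (by simp) ▸ mem_column.2 ⟨hd, .inl hdt⟩)).1
  refine ⟨fun d hd hdt => h.mem d (hmem d hd hdt) hdt,
    fun d hd hdt => h.unitDist d (hmem d hd hdt) hdt, hD t (by simp) ▸ h.nodup, ?_⟩
  rintro p hp rfl hpD q hq hpq
  rw [hfst q hpq.abs_fst_sub_le, hsnd q hpq.abs_fst_sub_le]
  exact h.trapped p ((hsnd p (by simp)).1 hp) rfl (mt (hfst p (by simp)).2 hpD) q hq hpq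

theorem LocallyTrapped.shift (h : LocallyTrapped S D t)
    (hS : ∀ p : ℤ × ℤ, t - 1 ≤ p.1 → (p + (s, 0) ∈ S ↔ p ∈ S)) :
    LocallyTrapped S (shiftEdges s D) (t + s) := by
  have hfst : ∀ p, p + (s, 0) ∈ (shiftEdges s D).map Prod.fst ↔ p ∈ D.map Prod.fst := by
    simp [shiftEdges]
  have hsnd : ∀ p, p + (s, 0) ∈ (shiftEdges s D).map Prod.snd ↔ p ∈ D.map Prod.snd := by
    simp [shiftEdges]
  have hunit : ∀ p q, UnitDist (p + (s, 0)) (q + (s, 0)) ↔ UnitDist p q := by simp [UnitDist]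
  refine ⟨fun d hd hdt => ?_, fun d hd hdt => ?_, ?_, ?_⟩
  · obtain ⟨e, he, rfl⟩ := List.mem_map.1 hd
    replace hdt : e.1.1 = t := add_right_cancel hdt
    have := abs_le.1 (h.unitDist e he hdt).abs_fst_sub_le
    have hmem := h.mem e he hdt
    exact ⟨(hS _ (by omega)).2 hmem.1, (hS _ (by omega)).2 hmem.2⟩
  · obtain ⟨e, he, rfl⟩ := List.mem_map.1 hd
    exact (hunit _ _).2 (h.unitDist e he (add_right_cancel hdt))
  · rw [column_shiftEdges, add_sub_cancel_right, shiftEdges, List.map_map]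
    have := h.nodup.map (add_left_injective ((s, 0) : ℤ × ℤ))
    rwa [List.map_map] at this
  · intro p hp hpt hpD q hq hpq
    obtain ⟨p, rfl⟩ : ∃ p', p = p' + (s, 0) := ⟨p - (s, 0), by simp⟩
    obtain ⟨q, rfl⟩ : ∃ q', q = q' + (s, 0) := ⟨q - (s, 0), by simp⟩
    rw [hfst, hsnd] at *
    rw [hunit] at hpq
    replace hpt : p.1 = t := add_right_cancel hpt
    have := abs_le.1 hpq.abs_fst_sub_le
    exact h.trapped p hp hpt hpD q ((hS q (by omega)).1 hq) hpq

namespace IsTrappedPath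

theorem mem (h : IsTrappedPath S v D) (hd : d ∈ D) : d.1 ∈ S ∧ d.2 ∈ S :=
  (h.locallyTrapped d.1.1).mem d hd rfl

theorem unitDist (h : IsTrappedPath S v D) (hd : d ∈ D) : UnitDist d.1 d.2 :=
  (h.locallyTrapped d.1.1).unitDist d hd rfl

theorem nodup_map_snd (h : IsTrappedPath S v D) : (D.map Prod.snd).Nodup :=
  nodup_map_snd_of_forall_column fun t => (h.locallyTrapped t).nodup

theorem nodup_map_fst (h : IsTrappedPath S v D) : (D.map Prod.fst).Nodup :=
  (List.nodup_cons.2 ⟨h.start_notMem, h.nodup_map_snd⟩).sublist h.chain.map_fst_sublist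

theorem exists_glue (hD : IsTrappedPath S v D) (hD' : IsTrappedPath S v D')
    (hv : s = 0 ∨ v.1 ≤ i ∧ v.1 + s ≤ i)
    (hS : ∀ p : ℤ × ℤ, i ≤ p.1 + s → (p + (s, 0) ∈ S ↔ p ∈ S))
    (h0 : column i D = column i (shiftEdges s D'))
    (h1 : column (i + 1) D = column (i + 1) (shiftEdges s D')) :
    ∃ E, IsTrappedPath S v E ∧ (∀ t ≤ i + 1, column t E = column t D) ∧
      ∀ t ≥ i, column t E = column t (shiftEdges s D') := by
  have short : ∀ d ∈ D, |d.1.1 - d.2.1| ≤ 1 := fun d hd => (hD.unitDist hd).abs_fst_sub_le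
  have short' : ∀ d ∈ shiftEdges s D', |d.1.1 - d.2.1| ≤ 1 := fun d hd => by
    obtain ⟨e, he, rfl⟩ := List.mem_map.1 hd
    simpa using (hD'.unitDist he).abs_fst_sub_le
  obtain ⟨E, chain, left, right⟩ := exists_chain_glue hD.chain (hD'.chain.shiftEdges s)
    (hv.imp_left fun hs => by simp [hs]) short short' h0 h1
  have locallyTrapped' : ∀ t > i, LocallyTrapped S (shiftEdges s D') t := fun t ht => by
    simpa using (hD'.locallyTrapped (t - s)).shift fun p hp => hS p (by omega)
  refine ⟨E, ⟨chain, ?_, fun t => ?_⟩, left, right⟩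
  · rw [← mem_map_snd_column]
    rcases le_or_gt v.1 i with hvi | hvi
    · rw [left _ (by omega), mem_map_snd_column]
      exact hD.start_notMem
    · obtain rfl : s = 0 := hv.resolve_right fun h => by omega
      rw [right _ hvi.le, mem_map_snd_column, shiftEdges_zero]
      exact hD'.start_notMem
  · rcases le_or_gt t i with ht | ht
    · exact (hD.locallyTrapped t).congr fun u hu => left u (by have := abs_le.1 hu; omega)
    · exact (locallyTrapped' t ht).congr fun u hu => right u (by have := abs_le.1 hu; omega)

end IsTrappedPath

end TrappedPaths

section ColumnWords

/-- The edges at the column `t`, translated to the column `0`. -/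
noncomputable def normalColumn (D : List PlaneEdge) (t : ℤ) : List PlaneEdge :=
  shiftEdges (-t) (column t D)

/-- A letter encodes a column of an edge list: it consists of the distance to the starting column
if that lies to the right, and of the normalized edges at this column and at the next one. -/
abbrev Letter : Type := ℕ × List PlaneEdge × List PlaneEdge

/-- The letter of an edge list at the column `t`, where `c` is the starting column. Without its
first component, gluing two walks could move the start of one of them. -/
noncomputable def letter (c : ℤ) (D : List PlaneEdge) (t : ℤ) : Letter :=
  ((c - t).toNat, normalColumn D t, normalColumn D (t + 1))

/-- The word of the letters of an edge list at the `k` columns from the column `m` on. -/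
noncomputable def columnWord (c : ℤ) (D : List PlaneEdge) (m : ℤ) (k : ℕ) : List Letter :=
  (List.range k).map fun n : ℕ => letter c D (m + n)

/-- The columns that contain an endpoint of an edge of `D`. -/
def touchedColumns (D : List PlaneEdge) : Set ℤ := {t | column t D ≠ []}

/-- The leftmost and the rightmost column touched by `D` are `m` and `n`. -/
def Spans (D : List PlaneEdge) (m n : ℤ) : Prop :=
  IsLeast (touchedColumns D) m ∧ IsGreatest (touchedColumns D) n

/-- The words of the trapped paths in `S` that start at `v` and have an edge. -/
def columnLanguage (S : Set (ℤ × ℤ)) (v : ℤ × ℤ) : Language Letter :=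
  {l | ∃ D m k, IsTrappedPath S v D ∧ Spans D m (m + (k : ℕ)) ∧ l = columnWord v.1 D m (k + 1)}

variable {S : Set (ℤ × ℤ)} {v : ℤ × ℤ} {c i m m' n s t : ℤ} {k k' h : ℕ} {d : PlaneEdge}
  {D D' E : List PlaneEdge}

theorem normalColumn_inj : normalColumn D t = normalColumn D' t ↔ column t D = column t D' :=
  (shiftEdges_injective _).eq_iff

theorem normalColumn_shiftEdges (s t : ℤ) (D : List PlaneEdge) :
    normalColumn (shiftEdges s D) (t + s) = normalColumn D t := by
  rw [normalColumn, normalColumn, column_shiftEdges, shiftEdges_shiftEdges]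
  congr 1 <;> simp

theorem length_columnWord : (columnWord c D m k).length = k := by
  simp [columnWord]

theorem columnWord_add (c : ℤ) (D : List PlaneEdge) (m : ℤ) (k k' : ℕ) :
    columnWord c D m (k + k') = columnWord c D m k ++ columnWord c D (m + k) k' := by
  simp [columnWord, List.range_add, Function.comp_def, add_assoc]

theorem columnWord_succ (c : ℤ) (D : List PlaneEdge) (m : ℤ) (k : ℕ) :
    columnWord c D m (k + 1) = letter c D m :: columnWord c D (m + 1) k := by
  rw [add_comm, columnWord_add]
  simp [columnWord]

theorem append_cons_eq_columnWord {u w : List Letter} {a : Letter}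
    (h : u ++ a :: w = columnWord c D m k) :
    k = u.length + (w.length + 1) ∧ u = columnWord c D m u.length ∧ a = letter c D (m + u.length) ∧
      w = columnWord c D (m + u.length + 1) w.length := by
  obtain rfl : u.length + (w.length + 1) = k := by
    simpa [length_columnWord] using congrArg List.length h
  rw [columnWord_add, columnWord_succ] at h
  obtain ⟨hu, haw⟩ := List.append_inj h length_columnWord.symm
  obtain ⟨ha, hw⟩ := List.cons.inj haw
  exact ⟨rfl, hu, ha, hw⟩

theorem letter_inj : letter c D t = letter c D' t ↔
    column t D = column t D' ∧ column (t + 1) D = column (t + 1) D' := by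
  simp [letter, normalColumn_inj]

theorem columnWord_congr (h : ∀ t, m ≤ t → t ≤ m + k → column t D = column t D') :
    columnWord c D m k = columnWord c D' m k :=
  List.map_congr_left fun n hn => by
    have := List.mem_range.1 hn
    exact letter_inj.2 ⟨h _ (by omega) (by omega), h _ (by omega) (by omega)⟩

theorem letter_shiftEdges (hs : s = 0 ∨ c ≤ t ∧ c ≤ t + s) :
    letter c (shiftEdges s D) (t + s) = letter c D t := by
  have : (c - (t + s)).toNat = (c - t).toNat := by omega
  rw [letter, letter, this, normalColumn_shiftEdges, add_right_comm, normalColumn_shiftEdges]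

theorem start_le_of_letter_eq (h : letter c D (t + s) = letter c D' t) :
    s = 0 ∨ c ≤ t ∧ c ≤ t + s := by
  have : (c - (t + s)).toNat = (c - t).toNat := congrArg Prod.fst h
  omega

theorem columnWord_shiftEdges (hs : s = 0 ∨ c ≤ m ∧ c ≤ m + s) :
    columnWord c (shiftEdges s D) (m + s) k = columnWord c D m k :=
  List.map_congr_left fun n _ => by
    rw [add_right_comm]
    exact letter_shiftEdges (by omega)

theorem touchedColumns_shiftEdges :
    t ∈ touchedColumns (shiftEdges s D) ↔ t - s ∈ touchedColumns D := by
  rw [touchedColumns, Set.mem_ofPred_eq, column_shiftEdges]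
  exact List.map_eq_nil_iff.not

theorem Spans.shiftEdges (h : Spans D m n) (s : ℤ) : Spans (shiftEdges s D) (m + s) (n + s) := by
  refine ⟨⟨touchedColumns_shiftEdges.2 ?_, fun t ht => ?_⟩,
    touchedColumns_shiftEdges.2 ?_, fun t ht => ?_⟩
  · simpa using h.1.1
  · exact le_sub_iff_add_le.1 (h.1.2 (touchedColumns_shiftEdges.1 ht))
  · simpa using h.2.1
  · exact sub_le_iff_le_add.1 (h.2.2 (touchedColumns_shiftEdges.1 ht))

theorem Spans.glue {n' : ℤ} (h : Spans D m n) (h' : Spans D' m' n') (hm : m ≤ i) (hn : i ≤ n')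
    (left : ∀ t ≤ i, column t E = column t D) (right : ∀ t ≥ i, column t E = column t D') :
    Spans E m n' := by
  have touched_left : ∀ t ≤ i, t ∈ touchedColumns E ↔ t ∈ touchedColumns D := fun t ht => by
    rw [touchedColumns, Set.mem_ofPred_eq, left t ht]; rfl
  have touched_right : ∀ t ≥ i, t ∈ touchedColumns E ↔ t ∈ touchedColumns D' := fun t ht => by
    rw [touchedColumns, Set.mem_ofPred_eq, right t ht]; rfl
  refine ⟨⟨(touched_left m hm).2 h.1.1, fun t ht => ?_⟩,
    (touched_right n' hn).2 h'.2.1, fun t ht => ?_⟩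
  · rcases le_total t i with hti | hti
    · exact h.1.2 ((touched_left t hti).1 ht)
    · exact hm.trans hti
  · rcases le_total t i with hti | hti
    · exact hti.trans hn
    · exact h'.2.2 ((touched_right t hti).1 ht)

theorem mem_touchedColumns_fst (hd : d ∈ D) : d.1.1 ∈ touchedColumns D :=
  List.ne_nil_of_mem (mem_column.2 ⟨hd, .inl rfl⟩)

theorem Spans.column_eq_nil (h : Spans D m n) (ht : t < m ∨ n < t) : column t D = [] := by
  by_contra hne
  exact ht.elim (h.1.2 hne).not_gt (h.2.2 hne).not_gt

theorem Spans.ne_nil (h : Spans D m n) : D ≠ [] := by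
  rintro rfl
  exact h.1.1 rfl

theorem Spans.nonneg (h : Spans D m n) (hD : IsTrappedPath (stripSet k) v D) : 0 ≤ m := by
  obtain ⟨d, hd⟩ := List.exists_mem_of_ne_nil _ h.1.1
  obtain ⟨hdD, rfl | rfl⟩ := mem_column.1 hd
  exacts [(hD.mem hdD).1.1, (hD.mem hdD).2.1]

theorem Spans.le_start (h : Spans D m n) (hD : IsTrappedPath S v D) : m ≤ v.1 := by
  obtain ⟨d, hd, rfl⟩ := List.mem_map.1 (hD.chain.mem_map_fst h.ne_nil)
  exact h.1.2 (mem_touchedColumns_fst hd)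

theorem IsTrappedPath.exists_glue_of_letter_eq (hD : IsTrappedPath (stripSet h) v D)
    (hD' : IsTrappedPath (stripSet h) v D') (ht : 0 ≤ t) (hts : 0 ≤ t + s)
    (heq : letter v.1 D (t + s) = letter v.1 D' t) :
    ∃ E, IsTrappedPath (stripSet h) v E ∧ (∀ u ≤ t + s + 1, column u E = column u D) ∧
      ∀ u ≥ t + s, column u E = column u (shiftEdges s D') := by
  have hs := start_le_of_letter_eq heq
  rw [← letter_shiftEdges hs, letter_inj] at heq
  refine hD.exists_glue hD' (by omega) (fun p hp => ?_) heq.1 heq.2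
  simp only [stripSet, Set.mem_ofPred_eq, Prod.fst_add, Prod.snd_add, add_zero]
  omega

theorem swapClosed_columnLanguage (h : ℕ) (v : ℤ × ℤ) :
    SwapClosed (columnLanguage (stripSet h) v) := by
  rintro u w u' w' a ⟨D, m, k, hD, hspan, hw⟩ ⟨D', m', k', hD', hspan', hw'⟩
  obtain ⟨-, hu, ha, -⟩ := append_cons_eq_columnWord hw
  obtain ⟨hk', -, ha', hw'⟩ := append_cons_eq_columnWord hw'
  have hm := hspan.nonneg hD
  have hm' := hspan'.nonneg hD'
  obtain ⟨s, hs⟩ : ∃ s, m + u.length = m' + u'.length + s := ⟨_, (add_sub_cancel _ _).symm⟩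
  have heq := ha.symm.trans ha'
  rw [hs] at heq
  have hs' := start_le_of_letter_eq heq
  obtain ⟨E, hE, left, right⟩ :=
    hD.exists_glue_of_letter_eq hD' (by omega) (by omega) heq
  have hu' : u = columnWord v.1 E m u.length :=
    hu.trans (columnWord_congr fun t _ ht => (left t (by omega)).symm)
  have haw' : a :: w' = columnWord v.1 E (m + u.length) (w'.length + 1) := by
    rw [hs, columnWord_congr fun t ht _ => right t ht, columnWord_shiftEdges hs',
      columnWord_succ, ← ha', ← hw']
  have hspanE : Spans E m (m' + k' + s) :=
    hspan.glue (hspan'.shiftEdges s) (by omega) (by omega) (fun t ht => left t (by omega)) right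
  refine ⟨E, m, u.length + w'.length, hE, ?_, ?_⟩
  · convert hspanE using 1
    push_cast
    omega
  · rw [add_assoc, columnWord_add, ← hu', ← haw']

theorem IsTrappedPath.eq_of_columnWord_eq (hD : IsTrappedPath S v D) (hD' : IsTrappedPath S v D')
    (hspan : Spans D m (m + k)) (hspan' : Spans D' m' (m' + k'))
    (hw : columnWord v.1 D m (k + 1) = columnWord v.1 D' m' (k' + 1)) : D = D' := by
  obtain rfl : k = k' := by simpa [length_columnWord] using congrArg List.length hw
  obtain rfl : m = m' := by
    have hm := hspan.le_start hD
    have hm' := hspan'.le_start hD'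
    simp only [columnWord_succ, letter, List.cons.injEq, Prod.mk.injEq] at hw
    omega
  refine hD.chain.eq_of_perm hD'.chain hD.nodup_map_fst (perm_of_forall_column_eq fun t => ?_)
  by_cases ht : t < m ∨ m + k < t
  · rw [hspan.column_eq_nil ht, hspan'.column_eq_nil ht]
  · obtain ⟨n, rfl⟩ := Int.le.dest (not_lt.1 (not_or.1 ht).1)
    exact (letter_inj.1 (List.map_inj_left.1 hw n (List.mem_range.2 (by omega)))).1

theorem finite_setOf_nodup_subset {α : Type*} {A : Set α} (hA : A.Finite) :
    {l : List α | l.Nodup ∧ ∀ a ∈ l, a ∈ A}.Finite := by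
  classical
  have := hA.fintype
  refine ((List.finite_length_le A (Fintype.card A)).image (List.map Subtype.val)).subset ?_
  rintro l ⟨hl, hlA⟩
  lift l to List A using hlA
  exact ⟨l, (hl.of_map _).length_le_card, rfl⟩

theorem IsTrappedPath.finite_setOf_normalColumn (h : ℕ) (v : ℤ × ℤ) :
    {l | ∃ D t, IsTrappedPath (stripSet h) v D ∧ l = normalColumn D t}.Finite := by
  let B : Set (ℤ × ℤ) := Set.Icc (-1) 1 ×ˢ Set.Ico 0 (h : ℤ)
  have hB : B.Finite := (Set.finite_Icc _ _).prod (Set.finite_Ico _ _)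
  refine (finite_setOf_nodup_subset (hB.prod hB)).subset ?_
  rintro _ ⟨D, t, hD, rfl⟩
  refine ⟨((hD.locallyTrapped t).nodup.of_map _).map (add_left_injective _), fun d hd => ?_⟩
  obtain ⟨e, he, rfl⟩ := List.mem_map.1 hd
  obtain ⟨heD, het⟩ := mem_column.1 he
  have hdist := abs_le.1 (hD.unitDist heD).abs_fst_sub_le
  obtain ⟨⟨-, hfst⟩, -, hsnd⟩ := hD.mem heD
  simp only [B, Set.mem_prod, Set.mem_Icc, Set.mem_Ico, Prod.fst_add, Prod.snd_add, add_zero]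
  omega

theorem exists_alphabet_columnLanguage (h : ℕ) (v : ℤ × ℤ) :
    ∃ T : Finset Letter, ∀ l ∈ columnLanguage (stripSet h) v, ∀ a ∈ l, a ∈ T := by
  have hfin := IsTrappedPath.finite_setOf_normalColumn h v
  refine ⟨((Set.finite_Iic v.1.toNat).prod (hfin.prod hfin)).toFinset, ?_⟩
  rintro _ ⟨D, m, k, hD, hspan, rfl⟩ a ha
  obtain ⟨n, -, rfl⟩ := List.mem_map.1 ha
  have hm := hspan.nonneg hD
  rw [Set.Finite.mem_toFinset]
  exact ⟨Set.mem_Iic.2 (Int.toNat_le_toNat (by omega)), ⟨D, _, hD, rfl⟩, ⟨D, _, hD, rfl⟩⟩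

/-- The weight of a letter: the exponent of `x` is the number of edges that start in the column
of the letter, and every letter contributes one factor `y`. -/
noncomputable def letterWeight (a : Letter) : Fin 2 →₀ ℕ :=
  Finsupp.single 0 (a.2.1.countP fun d => d.1.1 = 0) + Finsupp.single 1 1

theorem letterWeight_ne_zero (a : Letter) : letterWeight a ≠ 0 := fun h => by
  simpa [letterWeight] using DFunLike.congr_fun h 1

theorem countP_normalColumn (D : List PlaneEdge) (t : ℤ) :
    (normalColumn D t).countP (fun d => d.1.1 = 0) = (D.map fun d => d.1.1).count t := by
  simp only [normalColumn, shiftEdges, List.count, List.countP_map, column, touching,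
    List.countP_filter]
  refine List.countP_congr fun d _ => ?_
  simp only [Set.mem_ofPred_eq, Function.comp_apply, Bool.and_eq_true, decide_eq_true_eq,
    beq_iff_eq, Prod.fst_add]
  omega

theorem sum_letterWeight (l : List Letter) : (l.map letterWeight).sum =
    Finsupp.single 0 (l.map fun a => a.2.1.countP fun d => d.1.1 = 0).sum +
      Finsupp.single 1 l.length := by
  induction l with
  | nil => simp
  | cons a l ih =>
    simp only [List.map_cons, List.sum_cons, ih, letterWeight, List.length_cons,
      Finsupp.single_add]
    abel

theorem Spans.sum_letterWeight_columnWord (h : Spans D m (m + k)) (c : ℤ) :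
    ((columnWord c D m (k + 1)).map letterWeight).sum =
      Finsupp.single 0 D.length + Finsupp.single 1 (k + 1) := by
  rw [sum_letterWeight, length_columnWord, columnWord, List.map_map]
  congr 2
  simp only [Function.comp_def, letter, countP_normalColumn]
  have hmem : ∀ t ∈ D.map (fun d => d.1.1), t ∈
      (Finset.range (k + 1)).image fun n : ℕ => m + n := by
    intro t ht
    obtain ⟨d, hd, rfl⟩ := List.mem_map.1 ht
    have hm := h.1.2 (mem_touchedColumns_fst hd)
    have hk := h.2.2 (mem_touchedColumns_fst hd)
    exact Finset.mem_image.2 ⟨(d.1.1 - m).toNat, Finset.mem_range.2 (by omega), by omega⟩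
  have hsum : ∑ t ∈ (Finset.range (k + 1)).image fun n : ℕ => m + n,
      (D.map fun d => d.1.1).count t = D.length := by
    simpa using Multiset.sum_count_eq_card
      fun t (ht : t ∈ (↑(D.map fun d => d.1.1) : Multiset ℤ)) => hmem t (Multiset.mem_coe.1 ht)
  rwa [Finset.sum_image (by simp)] at hsum

end ColumnWords

section Walks

variable {S : Set (ℤ × ℤ)} {u v : S} {q : ℤ × ℤ} {l : List Letter}
  {D : List PlaneEdge}

/-- The list of the directed edges of a walk on a grid graph. -/
def edgeList (p : (gridGraph S).Walk u v) : List PlaneEdge :=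
  p.darts.map fun d => (d.fst.1, d.snd.1)

theorem length_edgeList (p : (gridGraph S).Walk u v) : (edgeList p).length = p.length := by
  simp [edgeList]

theorem map_snd_edgeList (p : (gridGraph S).Walk u v) :
    u.1 :: (edgeList p).map Prod.snd = p.support.map Subtype.val := by
  rw [← p.cons_map_snd_darts]
  simp [edgeList, Function.comp_def]

theorem map_fst_edgeList (p : (gridGraph S).Walk u v) :
    (edgeList p).map Prod.fst ++ [v.1] = p.support.map Subtype.val := by
  rw [← p.map_fst_darts_append]
  simp [edgeList, Function.comp_def]

theorem chainOn_edgeList (p : (gridGraph S).Walk u v) : ChainOn Set.univ u.1 (edgeList p) := by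
  induction p with
  | nil => trivial
  | cons hab p ih => exact ⟨.inl rfl, ih⟩

theorem mem_edgeList_endpoints (p : (gridGraph S).Walk u v) (hp : edgeList p ≠ []) :
    q ∈ (edgeList p).map Prod.fst ∨ q ∈ (edgeList p).map Prod.snd ↔
      q ∈ p.support.map Subtype.val := by
  constructor
  · rintro (hq | hq)
    · exact map_fst_edgeList p ▸ List.mem_append_left _ hq
    · exact map_snd_edgeList p ▸ List.mem_cons_of_mem _ hq
  · rw [← map_snd_edgeList, List.mem_cons]
    rintro (rfl | hq)
    · exact .inl ((chainOn_edgeList p).mem_map_fst hp)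
    · exact .inr hq

theorem exists_walk_of_chainOn (hD : ChainOn Set.univ u.1 D) (hS : ∀ d ∈ D, d.2 ∈ S)
    (hunit : ∀ d ∈ D, UnitDist d.1 d.2) :
    ∃ (v : S) (p : (gridGraph S).Walk u v), edgeList p = D := by
  induction D generalizing u with
  | nil => exact ⟨u, .nil, rfl⟩
  | cons d D ih =>
    rw [List.forall_mem_cons] at hS hunit
    obtain ⟨v, p, hp⟩ := ih (u := ⟨d.2, hS.1⟩) hD.2 hS.2 hunit.2
    have hadj : (gridGraph S).Adj u ⟨d.2, hS.1⟩ := by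
      have := hunit.1
      rwa [← hD.eq_fst] at this
    exact ⟨v, .cons hadj p, congrArg₂ (fun x E => (x, d.2) :: E) hD.eq_fst hp⟩

theorem IsTrappedPath.exists_gsaw (hD : IsTrappedPath S v D) (hne : D ≠ []) :
    ∃ W : GSAW (gridGraph S) v, edgeList W.walk = D := by
  obtain ⟨w, p, rfl⟩ := exists_walk_of_chainOn hD.chain (fun d hd => (hD.mem hd).2)
    fun d hd => hD.unitDist hd
  have nodup : (p.support.map Subtype.val).Nodup := by
    rw [← map_snd_edgeList]
    exact List.nodup_cons.2 ⟨hD.start_notMem, hD.nodup_map_snd⟩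
  have last_notMem : w.1 ∉ (edgeList p).map Prod.fst := fun hw => by
    rw [← map_fst_edgeList] at nodup
    exact List.disjoint_of_nodup_append nodup hw (by simp)
  have last_mem : w.1 ∈ (edgeList p).map Prod.snd :=
    ((mem_edgeList_endpoints p hne).2 (List.mem_map_of_mem p.end_mem_support)).resolve_left
      last_notMem
  refine ⟨⟨w, p, .mk' nodup.of_map, fun x hx => ?_⟩, rfl⟩
  exact (List.mem_map_of_injective Subtype.val_injective).1 ((mem_edgeList_endpoints p hne).1
    ((hD.locallyTrapped w.1.1).trapped w.1 last_mem rfl last_notMem x.1 x.2 hx))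

namespace GSAW

variable (W : GSAW (gridGraph S) v)

theorem ext_of_edgeList_eq {W W' : GSAW (gridGraph S) v}
    (h : edgeList W.walk = edgeList W'.walk) : W = W' := by
  obtain ⟨a, p, hp, tp⟩ := W
  obtain ⟨b, q, hq, tq⟩ := W'
  have hsupport : p.support = q.support := by
    apply List.map_injective_iff.2 Subtype.val_injective
    rw [← map_snd_edgeList, ← map_snd_edgeList]
    exact congrArg (v.1 :: List.map Prod.snd ·) h
  obtain rfl : a = b := by
    rw [← p.getLast_support, ← q.getLast_support]
    simp only [hsupport]
  obtain rfl : p = q := SimpleGraph.Walk.ext_support hsupport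
  rfl

theorem edgeList_ne_nil (hv : ∃ w, (gridGraph S).Adj v w) : edgeList W.walk ≠ [] := by
  obtain ⟨b, p, hp, tp⟩ := W
  obtain ⟨w, hw⟩ := hv
  cases p with
  | cons hab p => exact List.cons_ne_nil _ _
  | nil => exact absurd (List.mem_singleton.1 (tp w hw)) hw.ne'

theorem isTrappedPath : IsTrappedPath S v (edgeList W.walk) := by
  have hnd : (W.walk.support.map Subtype.val).Nodup :=
    W.isPath.support_nodup.map Subtype.val_injective
  rw [← map_snd_edgeList, List.nodup_cons] at hnd
  refine ⟨chainOn_edgeList W.walk, hnd.1, fun t => ⟨fun d hd _ => ?_, fun d hd _ => ?_,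
    hnd.2.sublist (List.filter_sublist.map _), fun p hp _ hp' q hq hpq => ?_⟩⟩
  · obtain ⟨e, -, rfl⟩ := List.mem_map.1 hd
    exact ⟨e.fst.2, e.snd.2⟩
  · obtain ⟨e, -, rfl⟩ := List.mem_map.1 hd
    exact e.adj
  · have hne : edgeList W.walk ≠ [] := fun h => by simp [h] at hp
    obtain rfl : p = W.last.1 := by
      have := (mem_edgeList_endpoints W.walk hne).1 (.inr hp)
      rw [← map_fst_edgeList] at this
      simpa using (List.mem_append.1 this).resolve_left hp'
    exact (mem_edgeList_endpoints W.walk hne).2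
      (List.mem_map.2 ⟨⟨q, hq⟩, W.trapped ⟨q, hq⟩ hpq, rfl⟩)

theorem touchedColumns_edgeList (hW : edgeList W.walk ≠ []) :
    touchedColumns (edgeList W.walk) = W.xCoords := by
  ext t
  trans ∃ q ∈ W.walk.support.map Subtype.val, q.1 = t
  · simp only [← mem_edgeList_endpoints W.walk hW, List.mem_map]
    rw [touchedColumns, Set.mem_ofPred_eq, Ne, List.eq_nil_iff_forall_not_mem, not_forall_not]
    simp only [mem_column]
    grind
  · simp [xCoords]

theorem spans (hW : edgeList W.walk ≠ []) :
    Spans (edgeList W.walk) (W.xCoords.min' W.xCoords_nonempty)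
      (W.xCoords.max' W.xCoords_nonempty) := by
  rw [Spans, W.touchedColumns_edgeList hW]
  exact ⟨W.xCoords.isLeast_min' _, W.xCoords.isGreatest_max' _⟩

theorem displacement_nonneg : 0 ≤ W.displacement :=
  sub_nonneg.2 (W.xCoords.min'_le _ (W.xCoords.max'_mem _))

theorem spans_add_displacement (hW : edgeList W.walk ≠ []) :
    Spans (edgeList W.walk) (W.xCoords.min' W.xCoords_nonempty)
      (W.xCoords.min' W.xCoords_nonempty + W.displacement.toNat) := by
  rw [Int.toNat_of_nonneg W.displacement_nonneg, displacement, add_sub_cancel]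
  exact W.spans hW

/-- The column word of a growing self-avoiding walk. -/
noncomputable def word : List Letter :=
  columnWord v.1.1 (edgeList W.walk) (W.xCoords.min' W.xCoords_nonempty)
    (W.displacement.toNat + 1)

theorem word_injective (hv : ∃ w, (gridGraph S).Adj v w) :
    Function.Injective (word : GSAW (gridGraph S) v → List Letter) := fun W W' h =>
  ext_of_edgeList_eq <| W.isTrappedPath.eq_of_columnWord_eq W'.isTrappedPath
    (W.spans_add_displacement (W.edgeList_ne_nil hv))
    (W'.spans_add_displacement (W'.edgeList_ne_nil hv)) h

theorem mem_columnLanguage_iff (hv : ∃ w, (gridGraph S).Adj v w) :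
    l ∈ columnLanguage S v ↔ ∃ W : GSAW (gridGraph S) v, W.word = l := by
  constructor
  · rintro ⟨D, m, k, hD, hspan, rfl⟩
    obtain ⟨W, rfl⟩ := hD.exists_gsaw hspan.ne_nil
    have hspanW := W.spans_add_displacement (W.edgeList_ne_nil hv)
    obtain rfl := hspan.1.unique hspanW.1
    obtain rfl : k = W.displacement.toNat :=
      Nat.cast_injective (add_left_cancel (hspan.2.unique hspanW.2))
    exact ⟨W, rfl⟩
  · rintro ⟨W, rfl⟩
    exact ⟨_, _, _, W.isTrappedPath, W.spans_add_displacement (W.edgeList_ne_nil hv), rfl⟩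

theorem sum_map_letterWeight_word (hv : ∃ w, (gridGraph S).Adj v w) :
    (W.word.map letterWeight).sum =
      Finsupp.single 0 W.length + Finsupp.single 1 (W.displacement.toNat + 1) := by
  rw [word, (W.spans_add_displacement (W.edgeList_ne_nil hv)).sum_letterWeight_columnWord,
    length_edgeList, length]

end GSAW

theorem mem_gsawSet_iff (hv : ∃ w, (gridGraph S).Adj v w) {m : Fin 2 →₀ ℕ}
    {W : GSAW (gridGraph S) v} : W ∈ gsawSet S v (m 0) (m 1) ↔
      (W.word.map letterWeight).sum = Finsupp.single 1 1 + m := by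
  rw [W.sum_map_letterWeight_word hv, add_comm _ 1, Finsupp.single_add, add_left_comm,
    add_right_inj]
  have := W.displacement_nonneg
  simp only [gsawSet, Fin.isValue, Set.mem_ofPred_eq, Finsupp.ext_iff, Finsupp.coe_add,
    Pi.add_apply, Fin.forall_fin_two, Finsupp.single_eq_same, ne_eq, zero_ne_one,
    not_false_eq_true, Finsupp.single_eq_of_ne, add_zero, one_ne_zero, zero_add,
    and_congr_right_iff]
  omega

/-- The factor `y` is there because a walk of displacement `k` touches `k + 1` columns. -/
theorem X_mul_gsawSeries (hv : ∃ w, (gridGraph S).Adj v w) :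
    MvPowerSeries.X 1 * gsawSeries S v = languageSeries ℚ letterWeight (columnLanguage S v) := by
  ext m
  have himage : {l ∈ columnLanguage S v | (l.map letterWeight).sum = m} =
      GSAW.word '' {W : GSAW (gridGraph S) v | (W.word.map letterWeight).sum = m} := by
    ext l
    simp only [GSAW.mem_columnLanguage_iff hv, Set.mem_ofPred_eq, Set.mem_image]
    grind
  rw [coeff_languageSeries, himage, Set.ncard_image_of_injective _ (GSAW.word_injective hv),
    MvPowerSeries.X_def]
  by_cases hm : Finsupp.single 1 1 ≤ m
  · obtain ⟨m, rfl⟩ := le_iff_exists_add.1 hm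
    simp only [← mem_gsawSet_iff hv]
    rw [MvPowerSeries.coeff_add_monomial_mul, one_mul]
    rfl
  · have hempty : {W : GSAW (gridGraph S) v | (W.word.map letterWeight).sum = m} = ∅ := by
      refine Set.eq_empty_of_forall_notMem fun W hW => hm (hW ▸ ?_)
      rw [W.sum_map_letterWeight_word hv, Finsupp.single_add]
      exact le_add_left le_add_self
    rw [hempty, Set.ncard_empty, MvPowerSeries.coeff_monomial_mul, if_neg hm, Nat.cast_zero]

theorem exists_adj_stripGraph {h : ℕ} (v : stripSet h) : ∃ w, (stripGraph h).Adj v w := by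
  have hw : v.1 + (1, 0) ∈ stripSet h := ⟨by simpa using add_nonneg v.2.1 zero_le_one,
    by simpa using v.2.2⟩
  exact ⟨⟨_, hw⟩, by simp [gridGraph]⟩

end Walks

theorem mainTheorem2_general (h : ℕ) (v : stripSet h) :
    IsRationalSeries (gsawSeries (stripSet h) v) := by
  obtain ⟨T, hT⟩ := exists_alphabet_columnLanguage h v.1
  have isRegular : (columnLanguage (stripSet h) v.1).IsRegular :=
    (swapClosed_columnLanguage h v.1).isRegular hT
  refine .of_X_mul (s := 1) ?_
  rw [X_mul_gsawSeries (exists_adj_stripGraph v)]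
  exact isRationalSeries_languageSeries isRegular hT letterWeight_ne_zero

theorem mainTheorem2 (h : ℕ) (hh : 1 ≤ h) : IsRationalSeries (stripSeries h hh) :=
  mainTheorem2_general h (topLeft h hh)
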